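/- Let $E$ be a finite set and let $X_t$ be an irreducible continuous-time Markov chain on $E$ with jump rates $r(x,y)\ge 0$, $x\neq y$ (and $r(x,x)=0$), holding rates $\lambda(x)=\sum_y r(x,y)$ and generator $(Lf)(x)=\sum_y r(x,y)[f(y)-f(x)]$. Let $\mu$ be a stationary measure: $\mu\ge 0$, $\mu\neq 0$ and $\sum_x\mu(x)(Lf)(x)=0$ for all $f:E\to\mathbb R$. The adjoint chain $X^*_t$ is the Markov chain with jump rates $r^*$ given by $\mu(x)r^*(x,y)=\mu(y)r(y,x)$. Denote by $\mathbb P_x$ (resp. $\mathbb P^*_x$) the law of $X_t$ (resp. $X^*_t$) started at $x$. For $A\subset E$ let $$T_A=\inf\{t>0: X_t\in A\},\qquad T_A^+=\inf\{t>0: X_t\in A,\ X_s\neq X_0 \text{ for some } 0<s<t\}.$$ For disjoint $A,B\subset E$ set $$\mathrm{Cap}(A,B)=\sum_{x\in A}\mu(x)\lambda(x)\,\mathbb P_x[T_A^+>T_B^+],$$ and for $a\neq b$ in $E$ set $V_{a,b}(x)=\mathbb P_x[T_{\{a\}}<T_{\{b\}}]$ and $V^*_{a,b}(x)=\mathbb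 P^*_x[T_{\{a\}}<T_{\{b\}}]$. Let $c(x,y)=\mu(x)r(x,y)$, $c^*(x,y)=\mu(x)r^*(x,y)$, $c_s=\tfrac12(c+c^*)$ and $\mathcal E=\{(x,y)\in E\times E: c_s(x,y)>0\}$. A flow is an anti-symmetric function $\varphi:\mathcal E\to\mathbb R$; on flows put $$\langle\varphi,\psi\rangle=\frac12\sum_{(x,y)\in\mathcal E}\frac{\varphi(x,y)\,\psi(x,y)}{c_s(x,y)},\qquad \|\varphi\|^2=\langle\varphi,\varphi\rangle.$$ Let $\mathcal C$ be the set of divergence free flows, i.e. flows with $\sum_{y:(x,y)\in\mathcal E}\varphi(x,y)=0$ for every $x\in E$. For $f:E\to\mathbb R$ define the flows $$\Phi_f(x,y)=f(x)c(x,y)-f(y)c(y,x),\qquad \Phi^*_f(x,y)=f(x)c^*(x,y)-f(y)c^*(y,x).$$ **Lemma.** Fix $a\neq b$ in $E$. Then $$\mathrm{Cap}(\{a\},\{b\})=\inf_f\ \inf_{\varphi\in\mathcal C}\ \|\Phi_f-\varphi\|^2,$$ where the first infimum is over all $f:E\to\mathbb R$ with $f(a)=1$ and $f(b)=0$. Moreover,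 the infimum is attained at $$f=\tfrac12\{V_{a,b}+V^*_{a,b}\},\qquad \varphi=\tfrac12\{\Phi_{V^*_{a,b}}-\Phi^*_{V_{a,b}}\},$$ and at no other pair $(f,\varphi)$ with $f(a)=1$, $f(b)=0$ and $\varphi\in\mathcal C$. -/

import Mathlib

open Finset MeasureTheory ProbabilityTheory
open scoped NNReal ENNReal

namespace CapFlow

section Chain

variable {E : Type*} [Fintype E]

/-- Holding rate `λ(x) = ∑ y, r(x,y)` of the chain with jump rates `r` (with `r(x,x) = 0`). -/
def holdRate (r : E → E → ℝ≥0) (x : E) : ℝ≥0 := ∑ y, r x y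

/-- Generator `(L f)(x) = ∑ y, r(x,y) (f(y) - f(x))`. -/
def generator (r : E → E → ℝ≥0) (f : E → ℝ) (x : E) : ℝ :=
  ∑ y, (r x y : ℝ) * (f y - f x)

/-- Irreducibility: any state can be reached from any other one by jumps of positive rate. -/
def IsIrred (r : E → E → ℝ≥0) : Prop :=
  ∀ x y, Relation.ReflTransGen (fun u v => 0 < r u v) x y

/-- `μ` is a stationary measure: it is non-zero and `∑ x, μ(x) (L f)(x) = 0` for all `f`.
It need not be normalized. -/
def IsStationary (r : E → E → ℝ≥0) (μ : E → ℝ≥0) : Prop :=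
  μ ≠ 0 ∧ ∀ f : E → ℝ, ∑ x, (μ x : ℝ) * generator r f x = 0

/-- Jump rates of the adjoint (time reversed) chain, `μ(x) r*(x,y) = μ(y) r(y,x)`. -/
noncomputable def adjRate (r : E → E → ℝ≥0) (μ : E → ℝ≥0) (x y : E) : ℝ≥0 :=
  μ y * r y x / μ x

open Classical in
/-- Law of the next state of the jump chain: `p(x,y) = r(x,y) / λ(x)`.
A state with `λ(x) = 0` is absorbing. -/
noncomputable def jumpLaw (r : E → E → ℝ≥0) (x : E) : PMF E :=
  if h : holdRate r x = 0 then PMF.pure x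
  else PMF.ofFintype (fun y => ((r x y / holdRate r x : ℝ≥0) : ℝ≥0∞)) (by
    rw [← ENNReal.ofNNReal_finsetSum, ← Finset.sum_div]
    change ((holdRate r x / holdRate r x : ℝ≥0) : ℝ≥0∞) = 1
    rw [div_self h, ENNReal.coe_one])

variable [MeasurableSpace E] [DiscreteMeasurableSpace E]

/-- Transition kernel of the jump chain. -/
noncomputable def jumpKernel (r : E → E → ℝ≥0) : Kernel E E :=
  Kernel.ofFunOfCountable fun x => (jumpLaw r x).toMeasure

instance (r : E → E → ℝ≥0) : IsMarkovKernel (jumpKernel r) :=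
  ⟨fun x => inferInstanceAs (IsProbabilityMeasure (jumpLaw r x).toMeasure)⟩

/-- The jump kernel as a kernel from the history up to step `n` to step `n + 1`;
it only looks at the current state. -/
noncomputable def stepKernel (r : E → E → ℝ≥0) (n : ℕ) :
    Kernel ((i : Finset.Iic n) → (fun _ : ℕ => E) i) E :=
  (jumpKernel r).comap (fun h => h ⟨n, Finset.mem_Iic.2 le_rfl⟩) (measurable_pi_apply _)

instance (r : E → E → ℝ≥0) (n : ℕ) : IsMarkovKernel (stepKernel r n) := by
  unfold stepKernel; infer_instance

/-- `ℙ_x`: the continuous-time chain started at `x` is carried by the product of the law of the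
jump chain `Y₀ = x, Y₁, Y₂, …` and of a sequence `ξ₀, ξ₁, …` of i.i.d. exponential variables of
parameter `1`. A sample point is `ω = (Y, ξ)`. -/
noncomputable def pathLaw (r : E → E → ℝ≥0) (x : E) : Measure ((ℕ → E) × (ℕ → ℝ)) :=
  ((Kernel.traj (X := fun _ : ℕ => E) (stepKernel r) 0) (fun _ => x)).prod
    (Measure.infinitePi fun _ : ℕ => expMeasure 1)


end Chain

section Dynamics

variable {E : Type*} [Fintype E]

/-- Time `S_n = ∑_{k < n} ξ_k / λ(Y_k)` of the `n`-th jump: the holding time at `Y_k` is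
exponential of parameter `λ(Y_k)` (and infinite if `λ(Y_k) = 0`). -/
noncomputable def jumpTime (r : E → E → ℝ≥0) (n : ℕ) (ω : (ℕ → E) × (ℕ → ℝ)) : ℝ≥0∞ :=
  ∑ k ∈ Finset.range n, ENNReal.ofReal (ω.2 k) / (holdRate r (ω.1 k) : ℝ≥0∞)

/-- The continuous-time Markov chain with jump rates `r`: `X_t = Y_n` for `S_n ≤ t < S_{n+1}`. -/
noncomputable def proc (r : E → E → ℝ≥0) (t : ℝ≥0) (ω : (ℕ → E) × (ℕ → ℝ)) : E :=
  ω.1 (sInf {n : ℕ | (t : ℝ≥0∞) < jumpTime r (n + 1) ω})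

/-- Hitting time `T_A = inf {t > 0 : X_t ∈ A}`, with `inf ∅ = ∞`. -/
noncomputable def hitTime (r : E → E → ℝ≥0) (A : Set E) (ω : (ℕ → E) × (ℕ → ℝ)) : ℝ≥0∞ :=
  sInf {s | ∃ t : ℝ≥0, s = t ∧ 0 < t ∧ proc r t ω ∈ A}

/-- Return time `T⁺_A = inf {t > 0 : X_t ∈ A, X_s ≠ X_0 for some 0 < s < t}`. -/
noncomputable def returnTime (r : E → E → ℝ≥0) (A : Set E) (ω : (ℕ → E) × (ℕ → ℝ)) : ℝ≥0∞ :=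
  sInf {s | ∃ t : ℝ≥0, s = t ∧ 0 < t ∧ proc r t ω ∈ A ∧
    ∃ u : ℝ≥0, 0 < u ∧ u < t ∧ proc r u ω ≠ proc r 0 ω}

variable [MeasurableSpace E] [DiscreteMeasurableSpace E]

/-- Equilibrium potential `V_{A,B}(x) = ℙ_x[T_A < T_B]`. -/
noncomputable def eqPot (r : E → E → ℝ≥0) (A B : Set E) (x : E) : ℝ :=
  (pathLaw r x).real {ω | hitTime r A ω < hitTime r B ω}

open Classical in
/-- Capacity `Cap(A,B) = ∑_{x ∈ A} M(x) ℙ_x[T⁺_A > T⁺_B]` with `M(x) = μ(x) λ(x)`. -/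
noncomputable def cap (r : E → E → ℝ≥0) (μ : E → ℝ≥0) (A B : Set E) : ℝ :=
  ∑ x with x ∈ A, (μ x : ℝ) * holdRate r x *
    (pathLaw r x).real {ω | returnTime r B ω < returnTime r A ω}

end Dynamics

section Flows

variable {E : Type*}

/-- Conductances `c(x,y) = μ(x) r(x,y)`. -/
noncomputable def cond (r : E → E → ℝ≥0) (μ : E → ℝ≥0) (x y : E) : ℝ := μ x * r x y

/-- Conductances `c*(x,y) = μ(x) r*(x,y)` of the adjoint chain. -/
noncomputable def condAdj (r : E → E → ℝ≥0) (μ : E → ℝ≥0) (x y : E) : ℝ :=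
  cond (adjRate r μ) μ x y

/-- Symmetric conductances `c_s = (c + c*) / 2`. -/
noncomputable def condSym (r : E → E → ℝ≥0) (μ : E → ℝ≥0) (x y : E) : ℝ :=
  (1 / 2) * (cond r μ x y + condAdj r μ x y)

/-- The set of arcs `{(x,y) : c_s(x,y) > 0}`. -/
def arcs (r : E → E → ℝ≥0) (μ : E → ℝ≥0) : Set (E × E) := {e | 0 < condSym r μ e.1 e.2}

/-- A flow is an anti-symmetric function on the arcs. It is identified with its extension
by zero to all pairs. -/
def IsFlow (r : E → E → ℝ≥0) (μ : E → ℝ≥0) (φ : E → E → ℝ) : Prop :=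
  (∀ x y, φ x y = -φ y x) ∧ ∀ x y, (x, y) ∉ arcs r μ → φ x y = 0

/-- The flow `(x,y) ↦ f(x) k(x,y) - f(y) k(y,x)`; it is `Φ_f` for `k = c` and `Φ*_f` for
`k = c*`. -/
def flowOf (k : E → E → ℝ) (f : E → ℝ) (x y : E) : ℝ := f x * k x y - f y * k y x

variable [Fintype E]

open Classical in
/-- Scalar product of flows, `⟨φ,ψ⟩ = (1/2) ∑_{(x,y) arc} φ(x,y) ψ(x,y) / c_s(x,y)`. -/
noncomputable def flowInner (r : E → E → ℝ≥0) (μ : E → ℝ≥0) (φ ψ : E → E → ℝ) : ℝ :=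
  (1 / 2) * ∑ e : E × E with e ∈ arcs r μ, 1 / condSym r μ e.1 e.2 * φ e.1 e.2 * ψ e.1 e.2

/-- `‖φ‖² = ⟨φ,φ⟩`. -/
noncomputable def flowNormSq (r : E → E → ℝ≥0) (μ : E → ℝ≥0) (φ : E → E → ℝ) : ℝ :=
  flowInner r μ φ φ

open Classical in
/-- Divergence `(div φ)(x) = ∑_{y : (x,y) arc} φ(x,y)`. -/
noncomputable def flowDiv (r : E → E → ℝ≥0) (μ : E → ℝ≥0) (φ : E → E → ℝ) (x : E) : ℝ :=
  ∑ y with (x, y) ∈ arcs r μ, φ x y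

/-- Divergence free flows. -/
def IsDivFree (r : E → E → ℝ≥0) (μ : E → ℝ≥0) (φ : E → E → ℝ) : Prop :=
  IsFlow r μ φ ∧ ∀ x, flowDiv r μ φ x = 0

/-- `‖Φ_f - φ‖²`. -/
noncomputable def energy (r : E → E → ℝ≥0) (μ : E → ℝ≥0) (f : E → ℝ) (φ : E → E → ℝ) : ℝ :=
  flowNormSq r μ (fun x y => flowOf (cond r μ) f x y - φ x y)

variable [MeasurableSpace E] [DiscreteMeasurableSpace E]

/-- `(V_{a,b} + V*_{a,b}) / 2`. -/
noncomputable def optFun (r : E → E → ℝ≥0) (μ : E → ℝ≥0) (a b : E) (x : E) : ℝ :=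
  (1 / 2) * (eqPot r {a} {b} x + eqPot (adjRate r μ) {a} {b} x)

/-- `(Φ_{V*_{a,b}} - Φ*_{V_{a,b}}) / 2`. -/
noncomputable def optFlow (r : E → E → ℝ≥0) (μ : E → ℝ≥0) (a b : E) (x y : E) : ℝ :=
  (1 / 2) * (flowOf (cond r μ) (eqPot (adjRate r μ) {a} {b}) x y
    - flowOf (condAdj r μ) (eqPot r {a} {b}) x y)

end Flows

end CapFlow

/-! Write V, V* for the two equilibrium potentials and f₀, φ₀ for the claimed minimiser. In Φ_{f₀} -
φ₀ all V* terms cancel, leaving the gradient flow c_s(x,y)(V(x) - V(y))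
(`flowOf_optFun_sub_optFlow`). Summation by parts pairs this gradient with a flow ψ as ∑ V(x) (div
ψ)(x), so divergence free flows are orthogonal to it. For g vanishing at a and b, so is Φ_g: div Φ_g
= -μ L*g, duality moves L* onto V as L, and LV vanishes off {a,b}. Hence Pythagoras
(`IsStationary.energy_eq`): the energy of (f, φ) is Cap plus the energy of (f - f₀, φ - φ₀). A zero
remainder makes Φ_g divergence free, so g is L*-harmonic everywhere, hence constant, hence 0; this
gives uniqueness.

Two facts remain. φ₀ is divergence free because V and V* carry the same current
(`IsStationary.sum_cond_mul_eqPot_eq`). Cap is the current of V out of a (`cap_eq_sum`), by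
reduction to the jump chain and a first-step analysis. -/

namespace CapFlow

/-! ### Pathwise reduction of continuous-time hitting and return times to the jump chain -/

section Paths

variable {E : Type*} [Fintype E] {r : E → E → ℝ≥0} {ω : (ℕ → E) × (ℕ → ℝ)}

lemma jumpTime_zero : jumpTime r 0 ω = 0 := by simp [jumpTime]

lemma jumpTime_succ (n : ℕ) : jumpTime r (n + 1) ω =
    jumpTime r n ω + ENNReal.ofReal (ω.2 n) / (holdRate r (ω.1 n) : ℝ≥0∞) := by
  simp [jumpTime, Finset.sum_range_succ]

lemma jumpTime_ne_top (hr : ∀ x, holdRate r x ≠ 0) (n : ℕ) : jumpTime r n ω ≠ ∞ := by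
  refine ENNReal.sum_ne_top.2 fun k _ => ENNReal.div_ne_top ENNReal.ofReal_ne_top ?_
  exact_mod_cast hr _

lemma jumpTime_strictMono (hr : ∀ x, holdRate r x ≠ 0) (hω : ∀ k, 0 < ω.2 k) :
    StrictMono fun n => jumpTime r n ω := by
  refine strictMono_nat_of_lt_succ fun n => ?_
  rw [jumpTime_succ]
  refine ENNReal.lt_add_right (jumpTime_ne_top hr n) ?_
  exact (ENNReal.div_pos (ENNReal.ofReal_pos.2 (hω n)).ne' ENNReal.coe_ne_top).ne'

lemma proc_eq (hr : ∀ x, holdRate r x ≠ 0) (hω : ∀ k, 0 < ω.2 k) {n : ℕ} {t : ℝ≥0}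
    (h₁ : jumpTime r n ω ≤ t) (h₂ : (t : ℝ≥0∞) < jumpTime r (n + 1) ω) :
    proc r t ω = ω.1 n := by
  have hleast : IsLeast {n : ℕ | (t : ℝ≥0∞) < jumpTime r (n + 1) ω} n := by
    refine ⟨h₂, fun m (hm : (t : ℝ≥0∞) < _) => ?_⟩
    by_contra! hlt
    have h₃ := (jumpTime_strictMono hr hω).monotone (Nat.succ_le_of_lt hlt)
    exact absurd (hm.trans_le (h₃.trans h₁)) (lt_irrefl _)
  rw [proc, hleast.csInf_eq]

/-- If no jump time exceeds t, the infimum of the empty set is 0 and the process sits at Y₀. Keeping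
this as the second alternative avoids having to prove non-explosion. -/
lemma exists_proc_eq (t : ℝ≥0) : ∃ k, proc r t ω = ω.1 k ∧ jumpTime r k ω ≤ t ∧
    ((t : ℝ≥0∞) < jumpTime r (k + 1) ω ∨ ∀ n, jumpTime r n ω ≤ t) := by
  refine ⟨_, rfl, ?_⟩
  rcases Set.eq_empty_or_nonempty {n : ℕ | (t : ℝ≥0∞) < jumpTime r (n + 1) ω} with h | h
  · rw [h, Nat.sInf_empty]
    have hle : ∀ n, jumpTime r n ω ≤ t := by
      rintro (_ | n)
      · simp [jumpTime_zero]
      · by_contra! hn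
        exact Set.notMem_empty n (h ▸ hn)
    exact ⟨hle 0, Or.inr hle⟩
  · refine ⟨?_, Or.inl (Nat.sInf_mem h)⟩
    rcases hk : sInf {n : ℕ | (t : ℝ≥0∞) < jumpTime r (n + 1) ω} with _ | m
    · simp [jumpTime_zero]
    · by_contra! hlt
      have : sInf {n : ℕ | (t : ℝ≥0∞) < jumpTime r (n + 1) ω} ≤ m := Nat.sInf_le hlt
      omega

lemma proc_zero (hr : ∀ x, holdRate r x ≠ 0) (hω : ∀ k, 0 < ω.2 k) : proc r 0 ω = ω.1 0 := by
  refine proc_eq hr hω (by simp [jumpTime_zero]) ?_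
  simpa [jumpTime_zero] using jumpTime_strictMono hr hω Nat.zero_lt_one

/-- The whole interval [S_n, S_{n+1}) is spent in A, so times just above S_n serve as witnesses.
This also covers n = 0, where S_0 = 0 itself is excluded by t > 0. -/
lemma hitTime_le (hr : ∀ x, holdRate r x ≠ 0) (hω : ∀ k, 0 < ω.2 k) {A : Set E} {n : ℕ}
    (hn : ω.1 n ∈ A) : hitTime r A ω ≤ jumpTime r n ω := by
  refine le_of_forall_gt_imp_ge_of_dense fun c hc => ?_
  obtain ⟨t, ht, ht'⟩ := ENNReal.lt_iff_exists_nnreal_btwn.1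
    (lt_min hc (jumpTime_strictMono hr hω (Nat.lt_succ_self n)))
  refine le_trans (b := (t : ℝ≥0∞)) ?_ (ht'.le.trans (min_le_left _ _))
  refine sInf_le ⟨t, rfl, ?_, ?_⟩
  · exact_mod_cast (zero_le.trans_lt ht : (0 : ℝ≥0∞) < t)
  · rwa [proc_eq hr hω ht.le (ht'.trans_le (min_le_right _ _))]

lemma le_hitTime (hr : ∀ x, holdRate r x ≠ 0) (hω : ∀ k, 0 < ω.2 k) {A : Set E} {n : ℕ}
    (hn : ∀ k ≤ n, ω.1 k ∉ A) : jumpTime r (n + 1) ω ≤ hitTime r A ω := by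
  refine le_sInf ?_
  rintro _ ⟨t, rfl, -, ht⟩
  obtain ⟨k, hk, hkt, -⟩ := exists_proc_eq (r := r) (ω := ω) t
  have : n < k := by
    by_contra! h
    exact hn k h (hk ▸ ht)
  exact ((jumpTime_strictMono hr hω).monotone this).trans hkt

lemma hitTime_eq_top {A : Set E} (hn : ∀ k, ω.1 k ∉ A) : hitTime r A ω = ∞ := by
  refine sInf_eq_top.2 ?_
  rintro _ ⟨t, rfl, -, ht⟩
  obtain ⟨k, hk, -⟩ := exists_proc_eq (r := r) (ω := ω) t
  exact absurd (hk ▸ ht) (hn k)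

lemma returnTime_le (hr : ∀ x, holdRate r x ≠ 0) (hω : ∀ k, 0 < ω.2 k) (h01 : ω.1 1 ≠ ω.1 0)
    {A : Set E} {n : ℕ} (hn : ω.1 (n + 1) ∈ A) :
    returnTime r A ω ≤ jumpTime r (n + 1) ω := by
  have hS := jumpTime_strictMono hr hω
  refine le_of_forall_gt_imp_ge_of_dense fun c hc => ?_
  obtain ⟨t, ht, ht'⟩ := ENNReal.lt_iff_exists_nnreal_btwn.1
    (lt_min hc (hS (Nat.lt_succ_self (n + 1))))
  -- The first jump time witnesses departure from Y₀; t > S_{n+1} strictly gives u < t even when n =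
  -- 0.
  obtain ⟨u, hu⟩ : ∃ u : ℝ≥0, (u : ℝ≥0∞) = jumpTime r 1 ω :=
    ⟨_, ENNReal.coe_toNNReal (jumpTime_ne_top hr 1)⟩
  refine le_trans (b := (t : ℝ≥0∞)) ?_ (ht'.le.trans (min_le_left _ _))
  refine sInf_le ⟨t, rfl, ?_, ?_, u, ?_, ?_, ?_⟩
  · exact_mod_cast (zero_le.trans_lt ht : (0 : ℝ≥0∞) < t)
  · rwa [proc_eq hr hω ht.le (ht'.trans_le (min_le_right _ _))]
  · have := hS Nat.zero_lt_one
    simp only [jumpTime_zero, ← hu] at this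
    exact_mod_cast this
  · have : (u : ℝ≥0∞) < t := hu ▸ (hS.monotone (show 1 ≤ n + 1 by omega)).trans_lt ht
    exact_mod_cast this
  · rwa [proc_zero hr hω, proc_eq hr hω hu.ge (hu ▸ hS (Nat.lt_succ_self 1))]

/-- Departure from the start forces t > S_1, so Y₀ is allowed to lie in A. -/
lemma le_returnTime (hr : ∀ x, holdRate r x ≠ 0) (hω : ∀ k, 0 < ω.2 k) {A : Set E} {n : ℕ}
    (hn : ∀ k < n, ω.1 (k + 1) ∉ A) : jumpTime r (n + 1) ω ≤ returnTime r A ω := by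
  have hS := jumpTime_strictMono hr hω
  refine le_sInf ?_
  rintro _ ⟨t, rfl, -, ht, u, -, hut, hu⟩
  obtain ⟨k, hk, hkt, h | h⟩ := exists_proc_eq (r := r) (ω := ω) t
  · have hu1 : jumpTime r 1 ω ≤ u := by
      by_contra! hlt
      exact hu ((proc_eq hr hω (by simp [jumpTime_zero]) hlt).trans (proc_zero hr hω).symm)
    have hk0 : k ≠ 0 := by
      rintro rfl
      exact absurd (h.trans_le hu1) (by exact_mod_cast hut.le.not_gt)
    obtain ⟨k, rfl⟩ := Nat.exists_eq_succ_of_ne_zero hk0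
    have : n ≤ k := by
      by_contra! hlt
      exact hn k hlt (hk ▸ ht)
    exact (hS.monotone (Nat.succ_le_succ this)).trans hkt
  · exact h _

lemma returnTime_eq_top {A : Set E} (hn : ∀ k, ω.1 k ∉ A) : returnTime r A ω = ∞ := by
  refine sInf_eq_top.2 ?_
  rintro _ ⟨t, rfl, -, ht, -⟩
  obtain ⟨k, hk, -⟩ := exists_proc_eq (r := r) (ω := ω) t
  exact absurd (hk ▸ ht) (hn k)

/-- The discrete paths that visit `a`, and do so before any visit to `b`. -/
def visitsBefore (a b : E) : Set (ℕ → E) := {Y | ∃ n, Y n = a ∧ ∀ k ≤ n, Y k ≠ b}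

lemma hitTime_lt_iff (hr : ∀ x, holdRate r x ≠ 0) (hω : ∀ k, 0 < ω.2 k) {a b : E} :
    hitTime r {a} ω < hitTime r {b} ω ↔ ω.1 ∈ visitsBefore a b := by
  classical
  have hS := jumpTime_strictMono hr hω
  constructor
  · intro hlt
    by_cases ha : ∃ n, ω.1 n = a
    · refine ⟨Nat.find ha, Nat.find_spec ha, fun k hk hkb => hlt.not_ge ?_⟩
      -- Equality means a = b, where the two hitting times coincide.
      rcases hk.eq_or_lt with rfl | hk
      · rw [← hkb, Nat.find_spec ha]
      obtain ⟨m, hm⟩ := Nat.exists_eq_succ_of_ne_zero (show Nat.find ha ≠ 0 by omega)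
      calc hitTime r {b} ω ≤ jumpTime r k ω := hitTime_le hr hω hkb
        _ ≤ jumpTime r (m + 1) ω := hS.monotone (by omega)
        _ ≤ hitTime r {a} ω := le_hitTime hr hω fun j hj => Nat.find_min ha (by omega)
    · push Not at ha
      rw [hitTime_eq_top (A := {a}) ha] at hlt
      exact absurd hlt not_top_lt
  · rintro ⟨n, hn, hb⟩
    exact (hitTime_le hr hω hn).trans_lt ((hS (Nat.lt_succ_self n)).trans_le
      (le_hitTime hr hω hb))

/-- Once the first jump leaves a, a return is a visit by the path shifted by one step. -/
lemma returnTime_lt_iff (hr : ∀ x, holdRate r x ≠ 0) (hω : ∀ k, 0 < ω.2 k) {a b : E}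
    (hab : a ≠ b) (h0 : ω.1 0 = a) (h1 : ω.1 1 ≠ a) :
    returnTime r {b} ω < returnTime r {a} ω ↔ (fun n => ω.1 (n + 1)) ∈ visitsBefore b a := by
  classical
  have hS := jumpTime_strictMono hr hω
  have h01 : ω.1 1 ≠ ω.1 0 := by rwa [h0]
  constructor
  · intro hlt
    by_cases hb : ∃ n, ω.1 (n + 1) = b
    · refine ⟨Nat.find hb, Nat.find_spec hb, fun k hk hka => hlt.not_ge ?_⟩
      calc returnTime r {a} ω ≤ jumpTime r (k + 1) ω := returnTime_le hr hω h01 hka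
        _ ≤ jumpTime r (Nat.find hb + 1) ω := hS.monotone (by omega)
        _ ≤ returnTime r {b} ω := le_returnTime hr hω fun j hj => Nat.find_min hb hj
    · push Not at hb
      rw [returnTime_eq_top (A := {b})] at hlt
      · exact absurd hlt not_top_lt
      · rintro (_ | k)
        · rw [h0]; exact hab
        · exact hb k
  · rintro ⟨n, hn, ha⟩
    exact (returnTime_le hr hω h01 hn).trans_lt ((hS (Nat.lt_succ_self (n + 1))).trans_le
      (le_returnTime hr hω fun k hk => ha k (by omega)))

end Paths

end CapFlow

namespace CapFlow

/-! ### Law of the jump chain and first-step analysis -/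

section JumpChain

/-- Every finite set of indices lies in an initial segment, so these marginals fix all
finite-dimensional ones. -/
lemma measure_ext_of_map_frestrictLe {X : ℕ → Type*} [∀ n, MeasurableSpace (X n)]
    {μ ν : Measure (∀ n, X n)} [IsFiniteMeasure μ]
    (h : ∀ n, μ.map (Preorder.frestrictLe n) = ν.map (Preorder.frestrictLe n)) : μ = ν := by
  refine IsProjectiveLimit.unique (P := fun I => μ.map I.restrict) (fun _ => rfl) fun I => ?_
  have hI := I.subset_Iic_sup_id
  simp only [← Finset.restrict₂_comp_restrict hI]
  rw [← Measure.map_map (by fun_prop) (by fun_prop), ← Measure.map_map (by fun_prop) (by fun_prop)]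
  exact congrArg _ (h _).symm

lemma infinitePi_expMeasure_ae_pos :
    ∀ᵐ ξ ∂(Measure.infinitePi fun _ : ℕ => expMeasure 1), ∀ k, 0 < ξ k := by
  have : IsProbabilityMeasure (expMeasure 1) := isProbabilityMeasure_expMeasure one_pos
  have hpos : ∀ᵐ x ∂(expMeasure 1), 0 < x := by
    rw [ae_iff]
    simp only [not_lt]
    change (volume.withDensity (exponentialPDF 1)) (Set.Iic 0) = 0
    rw [withDensity_apply _ measurableSet_Iic, setLIntegral_congr Iio_ae_eq_Iic.symm]
    exact lintegral_exponentialPDF_of_nonpos le_rfl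
  refine ae_all_iff.2 fun k => ?_
  exact (measurePreserving_eval_infinitePi (fun _ : ℕ => expMeasure 1) k).quasiMeasurePreserving.ae
    hpos

section

variable {E : Type*}

/-- Paths that agree with `s` up to time `n`. -/
def pathCyl (s : ℕ → E) (n : ℕ) : Set (ℕ → E) := {Y | ∀ k ≤ n, Y k = s k}

lemma pathCyl_eq_preimage (s : ℕ → E) (n : ℕ) :
    pathCyl s n = Preorder.frestrictLe (π := fun _ : ℕ => E) n ⁻¹'
      {Preorder.frestrictLe (π := fun _ : ℕ => E) n s} := by
  ext Y
  simp [pathCyl, funext_iff]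

/-- The path that starts at `x` and then follows `Y`. -/
def consPath (x : E) (Y : ℕ → E) : ℕ → E
  | 0 => x
  | n + 1 => Y n

lemma measurable_consPath [MeasurableSpace E] (x : E) : Measurable (consPath x) :=
  measurable_pi_lambda _ fun n => by
    cases n with
    | zero => exact measurable_const
    | succ n => exact measurable_pi_apply n

end

variable {E : Type*} [Fintype E] {r : E → E → ℝ≥0}

lemma jumpLaw_apply {x : E} (h : holdRate r x ≠ 0) (y : E) :
    jumpLaw r x y = ((r x y / holdRate r x : ℝ≥0) : ℝ≥0∞) := by
  simp [jumpLaw, h]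

lemma generator_eq_holdRate_mul {x : E} (hx : holdRate r x ≠ 0) (f : E → ℝ) :
    generator r f x = (holdRate r x : ℝ) * (∑ y, (r x y / holdRate r x : ℝ) * f y - f x) := by
  have h : (holdRate r x : ℝ) ≠ 0 := by exact_mod_cast hx
  have hs : (holdRate r x : ℝ) = ∑ y, (r x y : ℝ) := by simp [holdRate]
  rw [mul_sub, Finset.mul_sum, generator]
  simp only [mul_sub, Finset.sum_sub_distrib, ← Finset.sum_mul, ← hs]
  congr 1
  exact Finset.sum_congr rfl fun y _ => by field_simp

variable [MeasurableSpace E] [DiscreteMeasurableSpace E]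

/-- Law of the jump chain started at `x`. -/
noncomputable def chainLaw (r : E → E → ℝ≥0) (x : E) : Measure (ℕ → E) :=
  (Kernel.traj (X := fun _ : ℕ => E) (stepKernel r) 0) (fun _ => x)

instance (x : E) : IsProbabilityMeasure (chainLaw r x) := by
  unfold chainLaw; infer_instance

lemma measurableSet_pathCyl (s : ℕ → E) (n : ℕ) : MeasurableSet (pathCyl s n) := by
  have : pathCyl s n = ⋂ k, ⋂ _ : k ≤ n, (fun Y : ℕ → E => Y k) ⁻¹' {s k} := by
    ext; simp [pathCyl]
  rw [this]
  exact .iInter fun k => .iInter fun _ => measurable_pi_apply k (.singleton _)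

open Classical in
lemma chainLaw_pathCyl_zero (x : E) (s : ℕ → E) :
    chainLaw r x (pathCyl s 0) = if x = s 0 then 1 else 0 := by
  rw [pathCyl_eq_preimage, ← Measure.map_apply (by fun_prop) (.singleton _), chainLaw,
    Kernel.traj_map_frestrictLe_apply, Kernel.partialTraj_zero, Kernel.deterministic_apply,
    Measure.dirac_apply' _ (.singleton _), Set.indicator_apply]
  congr 1
  simp [funext_iff, Preorder.frestrictLe₂]

lemma chainLaw_pathCyl_succ (x : E) (s : ℕ → E) (n : ℕ) :
    chainLaw r x (pathCyl s (n + 1)) =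
      chainLaw r x (pathCyl s n) * jumpLaw r (s n) (s (n + 1)) := by
  set h : (i : Finset.Iic n) → (fun _ : ℕ => E) i := Preorder.frestrictLe n s
  have hset : pathCyl s (n + 1) = (fun Y : ℕ → E => (Preorder.frestrictLe n Y, Y (n + 1))) ⁻¹'
      ({h} ×ˢ {s (n + 1)}) := by
    ext Y
    simp only [h, pathCyl, Set.mem_ofPred_eq, Nat.le_succ_iff, Set.mem_preimage, Set.mem_prod,
      Set.mem_singleton_iff, funext_iff, Subtype.forall, Finset.mem_Iic,
      Preorder.frestrictLe_apply]
    exact ⟨fun h => ⟨fun k hk => h k (.inl hk), h _ (.inr rfl)⟩,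
      fun h k hk => hk.elim (h.1 k) (fun hk => hk ▸ h.2)⟩
  have hm : MeasurableSet ({h} ×ˢ {s (n + 1)} : Set (((i : Finset.Iic n) → E) × E)) :=
    (MeasurableSet.singleton _).prod (.singleton _)
  rw [hset, ← Measure.map_apply (by fun_prop) hm, chainLaw,
    ← Kernel.partialTraj_compProd_eq_map_traj (X := fun _ : ℕ => E) (Nat.zero_le n)
      (x₀ := fun _ => x), Measure.compProd_apply_prod (.singleton _) (.singleton _),
    Measure.restrict_singleton, lintegral_smul_measure, lintegral_dirac, smul_eq_mul,
    pathCyl_eq_preimage, ← Measure.map_apply (by fun_prop) (.singleton _),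
    Kernel.traj_map_frestrictLe_apply]
  congr 1
  exact PMF.toMeasure_apply_singleton _ _ (.singleton _)

/-- The trajectory construction appends factors at the end of the product of transition
probabilities; here the first factor is peeled off, which is the Markov property on cylinders. -/
lemma chainLaw_pathCyl_succ' (x : E) (s : ℕ → E) (n : ℕ) :
    chainLaw r x (pathCyl s (n + 1)) =
      chainLaw r x (pathCyl s 0) * jumpLaw r (s 0) (s 1) *
        chainLaw r (s 1) (pathCyl (fun k => s (k + 1)) n) := by
  induction n with
  | zero => simp [chainLaw_pathCyl_succ, chainLaw_pathCyl_zero (s 1)]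
  | succ n ih =>
    rw [chainLaw_pathCyl_succ, ih, chainLaw_pathCyl_succ (s 1), mul_assoc]

lemma chainLaw_pathCyl_eq_zero {x : E} {s : ℕ → E} (h : x ≠ s 0) (n : ℕ) :
    chainLaw r x (pathCyl s n) = 0 := by
  refine measure_mono_null (t := pathCyl s 0) (fun Y hY k hk => hY k (by omega)) ?_
  rw [chainLaw_pathCyl_zero, if_neg h]

/-- Markov property of the jump chain at time `1`. -/
lemma chainLaw_eq_sum (x : E) :
    chainLaw r x = ∑ y, jumpLaw r x y • (chainLaw r y).map (consPath x) := by
  classical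
  have hsum : ∑ y, jumpLaw r x y = 1 := by
    rw [← tsum_fintype (L := .unconditional E)]; exact PMF.tsum_coe _
  refine measure_ext_of_map_frestrictLe fun n => Measure.ext_of_singleton fun h => ?_
  obtain ⟨s, rfl⟩ : ∃ s : ℕ → E, h = Preorder.frestrictLe n s :=
    ⟨fun k => if hk : k ≤ n then h ⟨k, Finset.mem_Iic.2 hk⟩ else x, by
      ext ⟨k, hk⟩; simp [Finset.mem_Iic.1 hk]⟩
  rw [Measure.map_apply (by fun_prop) (.singleton _), Measure.map_apply (by fun_prop) (.singleton _),
    ← pathCyl_eq_preimage, Measure.finsetSum_apply]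
  simp only [Measure.smul_apply, smul_eq_mul,
    Measure.map_apply (measurable_consPath x) (measurableSet_pathCyl s n)]
  by_cases hx : x = s 0
  · rcases n with _ | n
    · have : consPath x ⁻¹' pathCyl s 0 = Set.univ := by
        ext Y; simp [pathCyl, consPath, hx]
      simp [this, chainLaw_pathCyl_zero, ← hx, hsum]
    · have : consPath x ⁻¹' pathCyl s (n + 1) = pathCyl (fun k => s (k + 1)) n := by
        ext Y
        refine ⟨fun h k hk => h (k + 1) (by omega), fun h k hk => ?_⟩
        rcases k with _ | k
        · exact hx
        · exact h k (by omega)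
      rw [this, chainLaw_pathCyl_succ', Finset.sum_eq_single (s 1), chainLaw_pathCyl_zero, if_pos hx,
        one_mul, ← hx]
      · intro y _ hy
        rw [chainLaw_pathCyl_eq_zero hy, mul_zero]
      · simp
  · rw [chainLaw_pathCyl_eq_zero hx]
    have : consPath x ⁻¹' pathCyl s n = ∅ := by
      ext Y
      simpa using fun h : consPath x Y ∈ pathCyl s n => hx (h 0 (Nat.zero_le n))
    simp [this]

lemma chainLaw_real_eq_sum (x : E) {S : Set (ℕ → E)} (hS : MeasurableSet S)
    (hx : holdRate r x ≠ 0) :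
    (chainLaw r x).real S =
      ∑ y, (r x y / holdRate r x : ℝ) * (chainLaw r y).real (consPath x ⁻¹' S) := by
  conv_lhs => rw [chainLaw_eq_sum]
  rw [measureReal_def, Measure.finsetSum_apply, ENNReal.toReal_sum]
  · refine Finset.sum_congr rfl fun y _ => ?_
    rw [Measure.smul_apply, smul_eq_mul, ENNReal.toReal_mul, jumpLaw_apply hx,
      Measure.map_apply (measurable_consPath x) hS]
    simp [measureReal_def]
  · intro y _
    rw [Measure.smul_apply, smul_eq_mul, jumpLaw_apply hx,
      Measure.map_apply (measurable_consPath x) hS]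
    exact ENNReal.mul_ne_top ENNReal.coe_ne_top (measure_ne_top _ _)

lemma chainLaw_ae_zero (x : E) : ∀ᵐ Y ∂chainLaw r x, Y 0 = x := by
  have h : chainLaw r x (pathCyl (fun _ => x) 0) = 1 := by simp [chainLaw_pathCyl_zero]
  filter_upwards [(mem_ae_iff_prob_eq_one (measurableSet_pathCyl _ _)).2 h] with Y hY
  exact hY 0 le_rfl

lemma chainLaw_ae_one_ne (hdiag : ∀ x, r x x = 0) {x : E} (hx : holdRate r x ≠ 0) :
    ∀ᵐ Y ∂chainLaw r x, Y 1 ≠ x := by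
  have hS : MeasurableSet {Y : ℕ → E | Y 1 = x} := 
    measurable_pi_apply (X := fun _ : ℕ => E) 1 (MeasurableSet.singleton x)
  rw [ae_iff]
  simp only [ne_eq, not_not]
  rw [← measureReal_eq_zero_iff, chainLaw_real_eq_sum x hS hx]
  refine Finset.sum_eq_zero fun y _ => ?_
  by_cases hy : y = x
  · simp [hy, hdiag]
  · have : (chainLaw r y).real (consPath x ⁻¹' {Y : ℕ → E | Y 1 = x}) = 0 := by
      rw [measureReal_eq_zero_iff]
      refine measure_mono_null (t := {Y | ¬ Y 0 = y}) (fun Y hY h => ?_)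
        (ae_iff.1 (chainLaw_ae_zero y))
      exact hy (h.symm.trans hY)
    rw [this, mul_zero]

lemma measurableSet_visitsBefore (a b : E) : MeasurableSet (visitsBefore a b) := by
  have : visitsBefore a b = ⋃ n, ((fun Y : ℕ → E => Y n) ⁻¹' {a} ∩
      ⋂ k, ⋂ _ : k ≤ n, (fun Y : ℕ → E => Y k) ⁻¹' {b}ᶜ) := by
    ext; simp [visitsBefore]
  rw [this]
  exact .iUnion fun n => (measurable_pi_apply n (.singleton _)).inter
    (.iInter fun k => .iInter fun _ => measurable_pi_apply k (.of_discrete))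

/-- The clocks are almost surely all positive, so T agrees up to a null set with the cylinder over
S, and the clocks integrate out. -/
lemma pathLaw_real_congr {x : E} {T : Set ((ℕ → E) × (ℕ → ℝ))} {S : Set (ℕ → E)}
    (h : ∀ᵐ Y ∂chainLaw r x, ∀ ξ : ℕ → ℝ, (∀ k, 0 < ξ k) → ((Y, ξ) ∈ T ↔ Y ∈ S)) :
    (pathLaw r x).real T = (chainLaw r x).real S := by
  have : IsProbabilityMeasure (expMeasure 1) := isProbabilityMeasure_expMeasure one_pos
  have hP : pathLaw r x = (chainLaw r x).prod (Measure.infinitePi fun _ : ℕ => expMeasure 1) := rfl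
  have h1 : ∀ᵐ ω ∂pathLaw r x, ∀ ξ : ℕ → ℝ, (∀ k, 0 < ξ k) → ((ω.1, ξ) ∈ T ↔ ω.1 ∈ S) :=
    hP ▸ Measure.quasiMeasurePreserving_fst.ae h
  have h2 : ∀ᵐ ω ∂pathLaw r x, ∀ k, 0 < ω.2 k :=
    hP ▸ Measure.quasiMeasurePreserving_snd.ae infinitePi_expMeasure_ae_pos
  have h3 : T =ᵐ[pathLaw r x] (S ×ˢ Set.univ : Set ((ℕ → E) × (ℕ → ℝ))) := by
    filter_upwards [h1, h2] with ω h1 h2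
    exact propext ((h1 _ h2).trans ⟨fun h => ⟨h, trivial⟩, fun h => h.1⟩)
  rw [measureReal_congr h3, hP, measureReal_prod_prod]
  simp

lemma eqPot_eq_chainLaw (hr : ∀ x, holdRate r x ≠ 0) (a b x : E) :
    eqPot r {a} {b} x = (chainLaw r x).real (visitsBefore a b) :=
  pathLaw_real_congr (.of_forall fun _ _ hξ => hitTime_lt_iff (ω := (_, _)) hr hξ)

lemma eqPot_left (hr : ∀ x, holdRate r x ≠ 0) {a b : E} (hab : a ≠ b) : eqPot r {a} {b} a = 1 := by
  rw [eqPot_eq_chainLaw hr, measureReal_def,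
    (mem_ae_iff_prob_eq_one (measurableSet_visitsBefore a b)).1, ENNReal.toReal_one]
  filter_upwards [chainLaw_ae_zero a] with Y hY
  exact ⟨0, hY, fun k hk => by rwa [Nat.le_zero.1 hk, hY]⟩

lemma eqPot_right (hr : ∀ x, holdRate r x ≠ 0) (a b : E) : eqPot r {a} {b} b = 0 := by
  rw [eqPot_eq_chainLaw hr, measureReal_eq_zero_iff]
  refine measure_mono_null (t := {Y | ¬ Y 0 = b}) ?_ (ae_iff.1 (chainLaw_ae_zero b))
  rintro Y ⟨n, -, hn⟩
  exact hn 0 (Nat.zero_le n)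

/-- Prepending a state other than a and b does not change which of them is visited first, so the
first-step formula makes V its own average. -/
lemma generator_eqPot (hr : ∀ x, holdRate r x ≠ 0) {a b x : E} (hxa : x ≠ a) (hxb : x ≠ b) :
    generator r (eqPot r {a} {b}) x = 0 := by
  rw [generator_eq_holdRate_mul (hr x)]
  have : consPath x ⁻¹' visitsBefore a b = visitsBefore a b := by
    ext Y
    constructor
    · rintro ⟨_ | n, hn, hb⟩
      · exact absurd hn hxa
      · exact ⟨n, hn, fun k hk => hb (k + 1) (by omega)⟩
    · rintro ⟨n, hn, hb⟩
      refine ⟨n + 1, hn, ?_⟩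
      rintro (_ | k) hk
      · exact hxb
      · exact hb k (by omega)
  simp only [eqPot_eq_chainLaw hr]
  rw [chainLaw_real_eq_sum x (measurableSet_visitsBefore a b) (hr x), this, sub_self, mul_zero]

lemma returnProb_eq_sum (hr : ∀ x, holdRate r x ≠ 0) (hdiag : ∀ x, r x x = 0) {a b : E} (hab : a ≠ b) :
    (pathLaw r a).real {ω | returnTime r {b} ω < returnTime r {a} ω} =
      ∑ y, (r a y / holdRate r a : ℝ) * eqPot r {b} {a} y := by
  rw [pathLaw_real_congr (S := {Y | (fun n => Y (n + 1)) ∈ visitsBefore b a}),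
    chainLaw_real_eq_sum a _ (hr a)]
  · exact Finset.sum_congr rfl fun y _ => by rw [eqPot_eq_chainLaw hr]; rfl
  · exact (measurableSet_visitsBefore b a).preimage (by fun_prop)
  · filter_upwards [chainLaw_ae_zero a, chainLaw_ae_one_ne hdiag (hr a)] with Y h0 h1 ξ hξ
    exact returnTime_lt_iff (ω := (Y, ξ)) hr hξ hab h0 h1

end JumpChain

end CapFlow

namespace CapFlow

/-! ### Adjoint chain, Dirichlet problem, and capacity as a current -/

section Harmonic

lemma condAdj_eq {E : Type*} {r : E → E → ℝ≥0} {μ : E → ℝ≥0} (hμ : ∀ x, 0 < μ x) (x y : E) : condAdj r μ x y = cond r μ y x := by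
  have : (μ x : ℝ) ≠ 0 := by exact_mod_cast (hμ x).ne'
  simp only [condAdj, cond, adjRate]
  push_cast
  field_simp

lemma cond_adjRate {E : Type*} {r : E → E → ℝ≥0} {μ : E → ℝ≥0} (hμ : ∀ x, 0 < μ x) (x y : E) :
    cond (adjRate r μ) μ x y = cond r μ y x :=
  condAdj_eq hμ x y

lemma IsIrred.adjRate {E : Type*} {r : E → E → ℝ≥0} {μ : E → ℝ≥0} (hirr : IsIrred r) (hμ : ∀ x, 0 < μ x) : IsIrred (adjRate r μ) := by
  intro x y
  have h := hirr y x
  induction h with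
  | refl => exact .refl
  | @tail u v _ huv ih => exact .head (div_pos (mul_pos (hμ u) huv) (hμ v)) ih

variable {E : Type*} [Fintype E] {r : E → E → ℝ≥0}

/-- Maximum principle. -/
lemma le_of_harmonic (hirr : IsIrred r) {S : Set E} {s : E} (hs : s ∈ S) {h : E → ℝ} {c : ℝ}
    (hharm : ∀ x ∉ S, generator r h x = 0) (hc : ∀ x ∈ S, h x ≤ c) (x : E) : h x ≤ c := by
  have : Nonempty E := ⟨s⟩
  obtain ⟨m, hm⟩ := Finite.exists_max h
  refine (hm x).trans ?_
  -- The maximal value propagates along a path from a maximiser m to s until the path meets S.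
  suffices H : ∀ z, Relation.ReflTransGen (fun u v => 0 < r u v) z s → h z = h m → h m ≤ c from
    H m (hirr m s) rfl
  intro z hz
  induction hz using Relation.ReflTransGen.head_induction_on with
  | refl => exact fun h => h ▸ hc s hs
  | @head u v huv _ ih =>
    intro hu
    by_cases huS : u ∈ S
    · exact hu ▸ hc u huS
    · refine ih ?_
      have hle : ∀ y ∈ Finset.univ, (r u y : ℝ) * (h y - h u) ≤ 0 := fun y _ =>
        mul_nonpos_of_nonneg_of_nonpos (r u y).coe_nonneg (by linarith [hm y])
      have := (Finset.sum_eq_zero_iff_of_nonpos hle).1 (hharm u huS) v (Finset.mem_univ v)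
      rcases mul_eq_zero.1 this with h0 | h0
      · exact absurd h0 (by exact_mod_cast huv.ne')
      · linarith

/-- Uniqueness for the Dirichlet problem. -/
lemma eq_of_generator_eq (hirr : IsIrred r) {S : Set E} {s : E} (hs : s ∈ S) {f g : E → ℝ}
    (hharm : ∀ x ∉ S, generator r f x = generator r g x) (hS : ∀ x ∈ S, f x = g x) : f = g := by
  have key : ∀ {f g : E → ℝ}, (∀ x ∉ S, generator r f x = generator r g x) →
      (∀ x ∈ S, f x = g x) → ∀ x, f x ≤ g x := by
    intro f g hharm hS x
    have := le_of_harmonic hirr hs (h := fun x => f x - g x) (c := 0) (fun x hx => ?_)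
      (fun x hx => by simp [hS x hx]) x
    · linarith
    · have := hharm x hx
      simp only [generator] at this ⊢
      rw [← sub_eq_zero, ← Finset.sum_sub_distrib] at this
      rw [← this]
      exact Finset.sum_congr rfl fun y _ => by ring
  exact funext fun x => le_antisymm (key hharm hS x)
    (key (fun x hx => (hharm x hx).symm) (fun x hx => (hS x hx).symm) x)

lemma IsIrred.holdRate_ne_zero (hirr : IsIrred r) {a b : E} (hab : a ≠ b) (x : E) :
    holdRate r x ≠ 0 := by
  obtain ⟨y, hy⟩ : ∃ y, x ≠ y := by
    by_cases h : x = a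
    · exact ⟨b, h ▸ hab⟩
    · exact ⟨a, h⟩
  rcases (hirr x y).cases_head with h | ⟨z, hz, -⟩
  · exact absurd h hy
  · exact (hz.trans_le (Finset.single_le_sum (f := r x) (fun _ _ => zero_le)
      (Finset.mem_univ z))).ne'

variable {μ : E → ℝ≥0}

/-- Stationarity tested on the indicator of x: inflow equals outflow. -/
lemma IsStationary.sum_cond (hμ : IsStationary r μ) (x : E) :
    ∑ y, cond r μ y x = ∑ y, cond r μ x y := by
  classical
  have h := hμ.2 (Pi.single x 1)
  simp only [generator, mul_sub, Finset.sum_sub_distrib, Finset.mul_sum, Pi.single_apply,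
    mul_ite, mul_one, mul_zero, Finset.sum_ite_eq', Finset.mem_univ, if_true] at h
  rw [sub_eq_zero] at h
  simp only [cond]
  rw [h, Finset.sum_eq_single x]
  · simp
  · intro z _ hz; simp [hz]
  · simp

/-- A state of zero mass has no outflow, hence no inflow; so positivity spreads along jumps. -/
lemma IsStationary.pos (hμ : IsStationary r μ) (hirr : IsIrred r) (x : E) : 0 < μ x := by
  obtain ⟨z, hz⟩ := Function.ne_iff.1 hμ.1
  have hz : 0 < μ z := pos_iff_ne_zero.2 hz
  have h := hirr z x
  induction h with
  | refl => exact hz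
  | @tail u v _ huv ih =>
    by_contra hv
    have hv : μ v = 0 := by simpa using hv
    have hb := hμ.sum_cond v
    have h0 : ∑ y, cond r μ v y = 0 := by simp [cond, hv]
    rw [h0, Finset.sum_eq_zero_iff_of_nonneg fun y _ => by unfold cond; positivity] at hb
    have := hb u (Finset.mem_univ u)
    have hp : 0 < cond r μ u v := by
      unfold cond
      exact mul_pos (by exact_mod_cast ih) (by exact_mod_cast huv)
    exact hp.ne' this

lemma mul_generator (f : E → ℝ) (x : E) :
    μ x * generator r f x = ∑ y, cond r μ x y * (f y - f x) := by
  simp only [generator, cond, Finset.mul_sum, mul_assoc]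

variable [MeasurableSpace E] [DiscreteMeasurableSpace E]

/-- V_{a,b} and 1 - V_{b,a} solve the same Dirichlet problem. Uniqueness thus replaces a recurrence
argument that {a,b} is almost surely reached. -/
lemma eqPot_add_eqPot_swap (hirr : IsIrred r) {a b : E} (hab : a ≠ b) (x : E) :
    eqPot r {a} {b} x + eqPot r {b} {a} x = 1 := by
  have hr := hirr.holdRate_ne_zero hab
  have := eq_of_generator_eq hirr (S := {a, b}) (s := a) (by simp)
    (f := fun x => eqPot r {a} {b} x) (g := fun x => 1 - eqPot r {b} {a} x) ?_ ?_
  · linarith [congrFun this x]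
  · intro x hx
    simp only [Set.mem_insert_iff, Set.mem_singleton_iff, not_or] at hx
    rw [generator_eqPot hr hx.1 hx.2]
    have h := generator_eqPot hr hx.2 hx.1
    rw [← neg_eq_zero] at h
    rw [← h, generator, generator, ← Finset.sum_neg_distrib]
    exact Finset.sum_congr rfl fun y _ => by ring
  · rintro x (rfl | rfl)
    · simp [eqPot_left hr hab, eqPot_right hr]
    · simp [eqPot_left hr hab.symm, eqPot_right hr]

lemma sum_cond_mul_eqPot (hirr : IsIrred r) {a b x : E} (hab : a ≠ b) (hxa : x ≠ a) (hxb : x ≠ b) :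
    ∑ y, cond r μ x y * (eqPot r {a} {b} x - eqPot r {a} {b} y) = 0 := by
  have h := mul_generator (r := r) (μ := μ) (eqPot r {a} {b}) x
  rw [generator_eqPot (hirr.holdRate_ne_zero hab) hxa hxb, mul_zero, eq_comm, ← neg_eq_zero,
    ← Finset.sum_neg_distrib] at h
  rw [← h]
  exact Finset.sum_congr rfl fun y _ => by ring

lemma cap_eq_sum (hdiag : ∀ x, r x x = 0) (hirr : IsIrred r) {a b : E} (hab : a ≠ b) :
    cap r μ {a} {b} = ∑ y, cond r μ a y * (eqPot r {a} {b} a - eqPot r {a} {b} y) := by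
  classical
  have hr := hirr.holdRate_ne_zero hab
  have h : (holdRate r a : ℝ) ≠ 0 := by exact_mod_cast hr a
  rw [cap]
  convert_to ∑ x ∈ ({a} : Finset E), (μ x : ℝ) * holdRate r x *
    (pathLaw r x).real {ω | returnTime r {b} ω < returnTime r {a} ω} = _
  · exact Finset.sum_congr (by ext; simp) fun _ _ => rfl
  rw [Finset.sum_singleton, returnProb_eq_sum hr hdiag hab, Finset.mul_sum]
  refine Finset.sum_congr rfl fun y _ => ?_
  rw [eqPot_left hr hab, ← eqPot_add_eqPot_swap hirr hab y, add_sub_cancel_left, cond]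
  field_simp

end Harmonic

end CapFlow

namespace CapFlow

/-! ### Flows, divergences and the orthogonal decomposition -/

section Flow

variable {E : Type*} {r : E → E → ℝ≥0} {μ : E → ℝ≥0} {φ ψ : E → E → ℝ}

lemma cond_nonneg (x y : E) : 0 ≤ cond r μ x y := by unfold cond; positivity

lemma flowNormSq_term_nonneg (φ : E → E → ℝ) {e : E × E} (he : e ∈ arcs r μ) :
    0 ≤ 1 / condSym r μ e.1 e.2 * φ e.1 e.2 * φ e.1 e.2 := by
  have : 0 < condSym r μ e.1 e.2 := he
  rw [mul_assoc]
  exact mul_nonneg (by positivity) (mul_self_nonneg _)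

lemma condSym_eq (hpos : ∀ x, 0 < μ x) (x y : E) :
    condSym r μ x y = (1 / 2) * (cond r μ x y + cond r μ y x) := by
  rw [condSym, condAdj_eq hpos]

lemma IsFlow.sub (hφ : IsFlow r μ φ) (hψ : IsFlow r μ ψ) :
    IsFlow r μ fun x y => φ x y - ψ x y :=
  ⟨fun x y => by linarith [hφ.1 x y, hψ.1 x y],
    fun x y h => by simp [hφ.2 x y h, hψ.2 x y h]⟩

lemma cond_eq_zero (hpos : ∀ x, 0 < μ x) {x y : E} (h : (x, y) ∉ arcs r μ) :
    cond r μ x y = 0 ∧ cond r μ y x = 0 := by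
  have h : ¬ 0 < condSym r μ x y := h
  rw [condSym_eq hpos] at h
  constructor <;> linarith [cond_nonneg (r := r) (μ := μ) x y, cond_nonneg (r := r) (μ := μ) y x]

lemma isFlow_flowOf (hpos : ∀ x, 0 < μ x) (f : E → ℝ) : IsFlow r μ (flowOf (cond r μ) f) :=
  ⟨fun x y => by simp [flowOf], fun x y h => by
    simp [flowOf, (cond_eq_zero hpos h).1, (cond_eq_zero hpos h).2]⟩

lemma isFlow_flowOf_adj (hpos : ∀ x, 0 < μ x) (f : E → ℝ) :
    IsFlow r μ (flowOf (condAdj r μ) f) :=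
  ⟨fun x y => by simp [flowOf], fun x y h => by
    simp [flowOf, condAdj_eq hpos, (cond_eq_zero hpos h).1, (cond_eq_zero hpos h).2]⟩

variable [Fintype E]

/-- Duality of L and L* in L²(μ): off-diagonal terms match by swapping x and y, diagonal ones by the
balance of c. -/
lemma sum_mul_sum_sub_comm {c : E → E → ℝ} (hc : ∀ x, ∑ y, c y x = ∑ y, c x y) (f g : E → ℝ) :
    ∑ x, f x * ∑ y, c y x * (g x - g y) = ∑ x, g x * ∑ y, c x y * (f x - f y) := by
  have h₁ : ∑ x, f x * ∑ y, c y x * (g x - g y) =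
      ∑ x, f x * g x * ∑ y, c y x - ∑ x, ∑ y, f x * g y * c y x := by
    simp only [mul_sub, Finset.sum_sub_distrib, Finset.mul_sum]
    congr 1 <;> exact Finset.sum_congr rfl fun x _ => Finset.sum_congr rfl fun y _ => by ring
  have h₂ : ∑ x, g x * ∑ y, c x y * (f x - f y) =
      ∑ x, f x * g x * ∑ y, c x y - ∑ x, ∑ y, f y * g x * c x y := by
    simp only [mul_sub, Finset.sum_sub_distrib, Finset.mul_sum]
    congr 1 <;> exact Finset.sum_congr rfl fun x _ => Finset.sum_congr rfl fun y _ => by ring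
  rw [h₁, h₂, Finset.sum_comm (f := fun x y => f x * g y * c y x)]
  simp only [hc]

lemma IsFlow.flowDiv_eq (hφ : IsFlow r μ φ) (x : E) : flowDiv r μ φ x = ∑ y, φ x y :=
  Finset.sum_subset (Finset.subset_univ _) fun y _ hy => hφ.2 x y (by simpa using hy)

lemma IsDivFree.sub (hφ : IsDivFree r μ φ) (hψ : IsDivFree r μ ψ) :
    IsDivFree r μ fun x y => φ x y - ψ x y := by
  refine ⟨hφ.1.sub hψ.1, fun x => ?_⟩
  rw [(hφ.1.sub hψ.1).flowDiv_eq, Finset.sum_sub_distrib, ← hφ.1.flowDiv_eq, ← hψ.1.flowDiv_eq,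
    hφ.2, hψ.2, sub_zero]

lemma flowInner_eq_sum (ψ : E → E → ℝ) (hφ : IsFlow r μ φ) :
    flowInner r μ ψ φ = (1 / 2) * ∑ x, ∑ y, 1 / condSym r μ x y * ψ x y * φ x y := by
  rw [flowInner, ← Fintype.sum_prod_type' (f := fun x y => 1 / condSym r μ x y * ψ x y * φ x y)]
  congr 1
  refine Finset.sum_subset (Finset.subset_univ _) fun e _ he => ?_
  rw [hφ.2 e.1 e.2 (by simpa using he), mul_zero]

/-- Summation by parts: the weight 1/c_s cancels on arcs, and antisymmetry doubles the V(x) term. -/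
lemma flowInner_gradient (V : E → ℝ) (hφ : IsFlow r μ φ) :
    flowInner r μ (fun x y => condSym r μ x y * (V x - V y)) φ = ∑ x, V x * ∑ y, φ x y := by
  have h₁ : ∀ x y, 1 / condSym r μ x y * (condSym r μ x y * (V x - V y)) * φ x y =
      V x * φ x y - V y * φ x y := by
    intro x y
    by_cases h : (x, y) ∈ arcs r μ
    · have : condSym r μ x y ≠ 0 := ne_of_gt h
      field_simp
    · simp [hφ.2 x y h]
  have h₂ : ∑ x, ∑ y, V y * φ x y = -∑ x, ∑ y, V x * φ x y := by
    rw [Finset.sum_comm, ← Finset.sum_neg_distrib]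
    refine Finset.sum_congr rfl fun x _ => ?_
    rw [← Finset.sum_neg_distrib]
    exact Finset.sum_congr rfl fun y _ => by rw [hφ.1 y x]; ring
  rw [flowInner_eq_sum _ hφ]
  simp only [h₁, Finset.sum_sub_distrib, h₂, Finset.mul_sum]
  ring

lemma flowNormSq_add (φ ψ : E → E → ℝ) :
    flowNormSq r μ (fun x y => φ x y + ψ x y) =
      flowNormSq r μ φ + 2 * flowInner r μ φ ψ + flowNormSq r μ ψ := by
  simp only [flowNormSq, flowInner, Finset.mul_sum, ← Finset.sum_add_distrib]
  exact Finset.sum_congr rfl fun e _ => by ring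

lemma flowNormSq_nonneg (φ : E → E → ℝ) : 0 ≤ flowNormSq r μ φ :=
  mul_nonneg (by norm_num) (Finset.sum_nonneg fun _ he =>
    flowNormSq_term_nonneg φ (by simpa using he))

lemma IsFlow.eq_zero_of_normSq (hφ : IsFlow r μ φ) (h : flowNormSq r μ φ = 0) (x y : E) :
    φ x y = 0 := by
  by_cases hxy : (x, y) ∈ arcs r μ
  · rw [flowNormSq, flowInner] at h
    have h := (mul_eq_zero.1 h).resolve_left (by norm_num)
    rw [Finset.sum_eq_zero_iff_of_nonneg fun e he =>
      flowNormSq_term_nonneg φ (by simpa using he)] at h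
    have := h (x, y) (by simpa using hxy)
    have hc : 0 < condSym r μ x y := hxy
    simpa [hc.ne'] using this
  · exact hφ.2 x y hxy

/-- By balance, div Φ_f = -μ L*f; likewise div Φ*_f = -μ Lf below. -/
lemma IsStationary.sum_flowOf (hμ : IsStationary r μ) (f : E → ℝ) (x : E) :
    ∑ y, flowOf (cond r μ) f x y = ∑ y, cond r μ y x * (f x - f y) := by
  simp only [flowOf, mul_sub, Finset.sum_sub_distrib, ← Finset.mul_sum,
    ← hμ.sum_cond x, mul_comm]

lemma IsStationary.sum_flowOf_adj (hμ : IsStationary r μ) (hpos : ∀ x, 0 < μ x) (f : E → ℝ)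
    (x : E) :
    ∑ y, flowOf (condAdj r μ) f x y = ∑ y, cond r μ x y * (f x - f y) := by
  simp only [flowOf, condAdj_eq hpos, mul_sub, Finset.sum_sub_distrib, ← Finset.mul_sum,
    hμ.sum_cond x, mul_comm]

/-- The constants are the only functions `f` with `Φ_f` divergence free. -/
lemma IsStationary.eq_zero_of_sum_flowOf (hμ : IsStationary r μ) (hirr : IsIrred r) {f : E → ℝ}
    {a : E} (ha : f a = 0) (h : ∀ x, ∑ y, flowOf (cond r μ) f x y = 0) : f = 0 := by
  have hpos := hμ.pos hirr
  refine eq_of_generator_eq (hirr.adjRate hpos) (S := {a}) (s := a) rfl (fun x _ => ?_)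
    (by simpa using ha)
  have h₁ : (μ x : ℝ) ≠ 0 := by exact_mod_cast (hpos x).ne'
  have h₂ : (μ x : ℝ) * generator (CapFlow.adjRate r μ) f x = 0 := by
    rw [mul_generator, ← neg_eq_zero, ← h x, hμ.sum_flowOf, ← Finset.sum_neg_distrib]
    refine Finset.sum_congr rfl fun y _ => ?_
    rw [cond_adjRate hpos]
    ring
  rw [(mul_eq_zero.1 h₂).resolve_left h₁]
  simp [generator]

lemma IsStationary.eq_zero_of_energy (hμ : IsStationary r μ) (hirr : IsIrred r) {f : E → ℝ} {a : E}
    (ha : f a = 0) (hφ : IsDivFree r μ φ) (h : energy r μ f φ = 0) : f = 0 ∧ φ = 0 := by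
  have hz := ((isFlow_flowOf (hμ.pos hirr) f).sub hφ.1).eq_zero_of_normSq h
  have hf : f = 0 := hμ.eq_zero_of_sum_flowOf hirr ha fun x => by
    rw [← hφ.2 x, hφ.1.flowDiv_eq]
    exact Finset.sum_congr rfl fun y _ => sub_eq_zero.1 (hz x y)
  refine ⟨hf, funext₂ fun x y => ?_⟩
  simpa [flowOf, hf] using hz x y

variable [MeasurableSpace E] [DiscreteMeasurableSpace E] {a b : E}

lemma sum_cond_mul_eqPot_adj (hirr : IsIrred r) (hpos : ∀ x, 0 < μ x) (hab : a ≠ b) {x : E}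
    (hxa : x ≠ a) (hxb : x ≠ b) :
    ∑ y, cond r μ y x *
      (eqPot (adjRate r μ) {a} {b} x - eqPot (adjRate r μ) {a} {b} y) = 0 := by
  simpa only [cond_adjRate hpos] using
    sum_cond_mul_eqPot (μ := μ) (hirr.adjRate hpos) hab hxa hxb

/-- The two equilibrium potentials carry the same current through every state. -/
lemma IsStationary.sum_cond_mul_eqPot_eq (hμ : IsStationary r μ) (hirr : IsIrred r) (hab : a ≠ b)
    (x : E) :
    ∑ y, cond r μ y x * (eqPot (adjRate r μ) {a} {b} x - eqPot (adjRate r μ) {a} {b} y) =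
      ∑ y, cond r μ x y * (eqPot r {a} {b} x - eqPot r {a} {b} y) := by
  classical
  have hpos := hμ.pos hirr
  have hr := hirr.holdRate_ne_zero hab
  have hr' := (hirr.adjRate hpos).holdRate_ne_zero hab
  set V := eqPot r {a} {b} with hV
  set W := eqPot (adjRate r μ) {a} {b} with hW
  set D := fun x => ∑ y, cond r μ x y * (V x - V y)
  set D' := fun x => ∑ y, cond r μ y x * (W x - W y)
  change D' x = D x
  have hD : ∀ z, z ≠ a → z ≠ b → D z = 0 := fun z => sum_cond_mul_eqPot hirr hab
  have hD' : ∀ z, z ≠ a → z ≠ b → D' z = 0 := fun z => sum_cond_mul_eqPot_adj hirr hpos hab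
  have hsum : ∀ (F G : E → ℝ), (∀ z, z ≠ a → z ≠ b → G z = 0) →
      ∑ z, F z * G z = F a * G a + F b * G b := by
    intro F G hG
    rw [← Finset.sum_pair hab (f := fun z => F z * G z)]
    refine (Finset.sum_subset (Finset.subset_univ _) fun z _ hz => ?_).symm
    simp only [Finset.mem_insert, Finset.mem_singleton, not_or] at hz
    rw [hG z hz.1 hz.2, mul_zero]
  -- Duality between V and V*: only a and b contribute, and the boundary values 1 and 0 isolate a.
  have hA : D' a = D a := by
    have := sum_mul_sum_sub_comm hμ.sum_cond V W
    change ∑ z, V z * D' z = ∑ z, W z * D z at this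
    rw [hsum V D' hD', hsum W D hD, hV, hW, eqPot_left hr hab, eqPot_right hr,
      eqPot_left hr' hab, eqPot_right hr'] at this
    linarith
  -- Duality against the constant 1: the total current vanishes, which fixes the value at b.
  have h₁ : D' a + D' b = 0 := by
    have := sum_mul_sum_sub_comm hμ.sum_cond (fun _ => 1) W
    change ∑ z, (fun _ => (1 : ℝ)) z * D' z = _ at this
    rw [hsum _ D' hD'] at this
    simpa using this
  have h₂ : D a + D b = 0 := by
    have := sum_mul_sum_sub_comm hμ.sum_cond V (fun _ => 1)
    change _ = ∑ z, (fun _ => (1 : ℝ)) z * D z at this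
    rw [hsum _ D hD] at this
    simpa using this.symm
  by_cases hxa : x = a
  · rw [hxa, hA]
  by_cases hxb : x = b
  · rw [hxb]; linarith
  rw [hD x hxa hxb, hD' x hxa hxb]

lemma IsStationary.isDivFree_optFlow (hμ : IsStationary r μ) (hirr : IsIrred r) (hab : a ≠ b) :
    IsDivFree r μ (optFlow r μ a b) := by
  have hpos := hμ.pos hirr
  have hflow : IsFlow r μ (optFlow r μ a b) := by
    have h := (isFlow_flowOf hpos (eqPot (adjRate r μ) {a} {b})).sub
      (isFlow_flowOf_adj (r := r) hpos (eqPot r {a} {b}))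
    exact ⟨fun x y => (congrArg (1 / 2 * ·) (h.1 x y)).trans (mul_neg _ _),
      fun x y hxy => (congrArg (1 / 2 * ·) (h.2 x y hxy)).trans (mul_zero _)⟩
  refine ⟨hflow, fun x => ?_⟩
  rw [hflow.flowDiv_eq]
  simp only [optFlow, ← Finset.mul_sum, Finset.sum_sub_distrib]
  rw [hμ.sum_flowOf, hμ.sum_flowOf_adj hpos, hμ.sum_cond_mul_eqPot_eq hirr hab, sub_self, mul_zero]

lemma flowOf_optFun_sub_optFlow (hpos : ∀ x, 0 < μ x) (a b x y : E) :
    flowOf (cond r μ) (optFun r μ a b) x y - optFlow r μ a b x y =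
      condSym r μ x y * (eqPot r {a} {b} x - eqPot r {a} {b} y) := by
  simp only [flowOf, optFun, optFlow, condSym_eq hpos, condAdj_eq hpos]
  ring

/-- The pairing of the equilibrium potential with `div Φ_g`, for `g` vanishing at `b`. -/
lemma IsStationary.sum_eqPot_mul (hμ : IsStationary r μ) (hirr : IsIrred r) (hab : a ≠ b)
    {g : E → ℝ} (hb : g b = 0) :
    ∑ x, eqPot r {a} {b} x * ∑ y, cond r μ y x * (g x - g y) =
      g a * ∑ y, cond r μ a y * (eqPot r {a} {b} a - eqPot r {a} {b} y) := by
  rw [sum_mul_sum_sub_comm hμ.sum_cond, Finset.sum_eq_single a]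
  · intro x _ hxa
    by_cases hxb : x = b
    · rw [hxb, hb, zero_mul]
    · rw [sum_cond_mul_eqPot hirr hab hxa hxb, mul_zero]
  · simp

lemma optFun_left (hirr : IsIrred r) (hpos : ∀ x, 0 < μ x) (hab : a ≠ b) :
    optFun r μ a b a = 1 := by
  rw [optFun, eqPot_left (hirr.holdRate_ne_zero hab) hab,
    eqPot_left ((hirr.adjRate hpos).holdRate_ne_zero hab) hab]
  norm_num

lemma optFun_right (hirr : IsIrred r) (hpos : ∀ x, 0 < μ x) (hab : a ≠ b) :
    optFun r μ a b b = 0 := by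
  rw [optFun, eqPot_right (hirr.holdRate_ne_zero hab),
    eqPot_right ((hirr.adjRate hpos).holdRate_ne_zero hab)]
  norm_num

/-- The energy is ∑ V div(c_s ∇V). Its c and c* halves are equal by duality, and harmonicity leaves
only the current out of a. -/
lemma IsStationary.energy_opt (hμ : IsStationary r μ) (hdiag : ∀ x, r x x = 0) (hirr : IsIrred r)
    (hab : a ≠ b) :
    energy r μ (optFun r μ a b) (optFlow r μ a b) = cap r μ {a} {b} := by
  have hpos := hμ.pos hirr
  have hr := hirr.holdRate_ne_zero hab
  set V := eqPot r {a} {b} with hV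
  have hflow := (isFlow_flowOf hpos (optFun r μ a b)).sub (hμ.isDivFree_optFlow hirr hab).1
  rw [energy, flowNormSq]
  simp only [flowOf_optFun_sub_optFlow hpos] at hflow ⊢
  rw [flowInner_gradient _ hflow, cap_eq_sum hdiag hirr hab, ← hV]
  have h₁ := hμ.sum_eqPot_mul hirr hab (g := V) (eqPot_right hr a b)
  have h₂ : ∑ x, V x * ∑ y, cond r μ x y * (V x - V y) = _ :=
    (sum_mul_sum_sub_comm hμ.sum_cond V V).symm
  rw [← hV] at h₁
  have ha : V a = 1 := eqPot_left hr hab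
  simp only [ha, one_mul] at h₁ ⊢
  simp only [condSym_eq hpos, mul_assoc, ← Finset.mul_sum, add_mul, Finset.sum_add_distrib,
    mul_add, mul_left_comm _ (1 / 2 : ℝ)]
  rw [h₂, h₁]
  ring

lemma IsStationary.energy_eq (hμ : IsStationary r μ) (hdiag : ∀ x, r x x = 0) (hirr : IsIrred r)
    (hab : a ≠ b) {f : E → ℝ} (ha : f a = 1) (hb : f b = 0) (hφ : IsDivFree r μ φ) :
    energy r μ f φ = cap r μ {a} {b} +
      energy r μ (fun x => f x - optFun r μ a b x) (fun x y => φ x y - optFlow r μ a b x y) := by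
  have hpos := hμ.pos hirr
  have hr := hirr.holdRate_ne_zero hab
  have hopt := hμ.isDivFree_optFlow hirr hab
  set g := fun x => f x - optFun r μ a b x with hg
  have hga : g a = 0 := by simp [hg, ha, optFun_left hirr hpos hab]
  have hgb : g b = 0 := by simp [hg, hb, optFun_right hirr hpos hab]
  have hη := hφ.sub hopt
  have hδ := (isFlow_flowOf hpos g).sub hη.1
  have hsum : ∀ x, ∑ y, (φ x y - optFlow r μ a b x y) = 0 := fun x =>
    (hη.1.flowDiv_eq x).symm.trans (hη.2 x)
  -- The cross term reduces to g(a) times the current out of a, and g(a) = 0.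
  have horth : flowInner r μ (fun x y => condSym r μ x y * (eqPot r {a} {b} x - eqPot r {a} {b} y))
      (fun x y => flowOf (cond r μ) g x y - (φ x y - optFlow r μ a b x y)) = 0 := by
    rw [flowInner_gradient _ hδ]
    simp only [Finset.sum_sub_distrib (f := flowOf (cond r μ) g _), hsum, sub_zero, hμ.sum_flowOf]
    rw [hμ.sum_eqPot_mul hirr hab hgb, hga, zero_mul]
  rw [← hμ.energy_opt hdiag hirr hab]
  have hsplit : (fun x y => flowOf (cond r μ) f x y - φ x y) = fun x y =>
      condSym r μ x y * (eqPot r {a} {b} x - eqPot r {a} {b} y) +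
        (flowOf (cond r μ) g x y - (φ x y - optFlow r μ a b x y)) := by
    funext x y
    rw [← flowOf_optFun_sub_optFlow hpos]
    simp only [flowOf, hg]
    ring
  simp only [energy]
  rw [hsplit, flowNormSq_add, horth]
  simp only [flowOf_optFun_sub_optFlow hpos]
  ring

end Flow

end CapFlow

theorem lemma3p2 {E : Type*} [Fintype E] [MeasurableSpace E] [DiscreteMeasurableSpace E]
    (r : E → E → ℝ≥0) (hdiag : ∀ x, r x x = 0) (hirr : CapFlow.IsIrred r)
    (μ : E → ℝ≥0) (hμ : CapFlow.IsStationary r μ) (a b : E) (hab : a ≠ b) :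
    (CapFlow.cap r μ {a} {b} =
      ⨅ f : {f : E → ℝ // f a = 1 ∧ f b = 0},
        ⨅ φ : {φ : E → E → ℝ // CapFlow.IsDivFree r μ φ}, CapFlow.energy r μ f.1 φ.1) ∧
    (CapFlow.optFun r μ a b a = 1 ∧ CapFlow.optFun r μ a b b = 0 ∧
      CapFlow.IsDivFree r μ (CapFlow.optFlow r μ a b) ∧
      CapFlow.energy r μ (CapFlow.optFun r μ a b) (CapFlow.optFlow r μ a b) =
        CapFlow.cap r μ {a} {b}) ∧
    ∀ (f : E → ℝ) (φ : E → E → ℝ), f a = 1 → f b = 0 → CapFlow.IsDivFree r μ φ →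
      CapFlow.cap r μ {a} {b} ≤ CapFlow.energy r μ f φ ∧
      (CapFlow.energy r μ f φ = CapFlow.cap r μ {a} {b} →
        f = CapFlow.optFun r μ a b ∧ φ = CapFlow.optFlow r μ a b) := by
  have hpos := hμ.pos hirr
  have hopt := hμ.isDivFree_optFlow hirr hab
  have ha := CapFlow.optFun_left hirr hpos hab
  have hb := CapFlow.optFun_right hirr hpos hab
  have hmin := hμ.energy_opt hdiag hirr hab
  have hnonneg : ∀ f φ, 0 ≤ CapFlow.energy r μ f φ := fun _ _ => CapFlow.flowNormSq_nonneg _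
  have hle : ∀ (f : E → ℝ) (φ : E → E → ℝ), f a = 1 → f b = 0 → CapFlow.IsDivFree r μ φ →
      CapFlow.cap r μ {a} {b} ≤ CapFlow.energy r μ f φ := fun f φ hfa hfb hφ => by
    rw [hμ.energy_eq hdiag hirr hab hfa hfb hφ]
    exact le_add_of_nonneg_right (hnonneg _ _)
  refine ⟨?_, ⟨ha, hb, hopt, hmin⟩, fun f φ hfa hfb hφ => ⟨hle f φ hfa hfb hφ, fun h => ?_⟩⟩
  · have : Nonempty {f : E → ℝ // f a = 1 ∧ f b = 0} := ⟨⟨_, ha, hb⟩⟩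
    have : Nonempty {φ : E → E → ℝ // CapFlow.IsDivFree r μ φ} := ⟨⟨_, hopt⟩⟩
    refine le_antisymm (le_ciInf fun f => le_ciInf fun φ => hle _ _ f.2.1 f.2.2 φ.2) ?_
    rw [← hmin]
    -- Real infima need a lower bound; 0 serves at both levels.
    have h₁ := ciInf_le (f := fun f : {f : E → ℝ // f a = 1 ∧ f b = 0} =>
      ⨅ φ : {φ : E → E → ℝ // CapFlow.IsDivFree r μ φ}, CapFlow.energy r μ f.1 φ.1)
      ⟨0, by rintro _ ⟨f, rfl⟩; exact Real.iInf_nonneg fun φ => hnonneg _ _⟩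
      ⟨CapFlow.optFun r μ a b, ha, hb⟩
    have h₂ := ciInf_le (f := fun φ : {φ : E → E → ℝ // CapFlow.IsDivFree r μ φ} =>
      CapFlow.energy r μ (CapFlow.optFun r μ a b) φ.1)
      ⟨0, by rintro _ ⟨φ, rfl⟩; exact hnonneg _ _⟩ ⟨CapFlow.optFlow r μ a b, hopt⟩
    exact h₁.trans h₂
  · rw [hμ.energy_eq hdiag hirr hab hfa hfb hφ, add_eq_left] at h
    have h₀ : f a - CapFlow.optFun r μ a b a = 0 := by rw [hfa, ha, sub_self]
    obtain ⟨h₁, h₂⟩ := hμ.eq_zero_of_energy hirr (a := a)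
      (f := fun x => f x - CapFlow.optFun r μ a b x) h₀ (hφ.sub hopt) h
    exact ⟨funext fun x => sub_eq_zero.1 (congrFun h₁ x),
      funext₂ fun x y => sub_eq_zero.1 (congrFun (congrFun h₂ x) y)⟩
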